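/- Let $K$ be a field, let $n\ge 1$, and let $L^n_\omega$ be a weighted path on the vertex set $\{1,\dots,n\}$, i.e. the graph with edges $e_i=\{i,i+1\}$ for $1\le i\le n-1$ together with a weight function $\omega$ assigning to each edge a positive integer. Let $$I=I(L^n_\omega)=\bigl(x_i^{\omega(e_i)}x_{i+1}^{\omega(e_i)} \,\bigm|\, 1\le i\le n-1\bigr)\subset K[x_1,\dots,x_n]$$ be its edge ideal. For an ideal $J$ of a commutative ring $R$, an element $f\in R$ is integral over $J$ if $f^k+c_1f^{k-1}+\dots+c_{k-1}f+c_k=0$ for some $k\ge 1$ and some $c_i\in J^i$ ($1\le i\le k$); the set $\overline{J}$ of all such elements is the integral closure of $J$; $J$ is integrally closed if $J=\overline{J}$, and $J$ is normal if $J^k$ is integrally closed for every $k\ge 1$. If $I$ is integrally closed, then $I$ is normal. -/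

import Mathlib

/-- `f` is integral over the ideal `I`: there is an equation
`f ^ k + c₁ f ^ (k - 1) + ⋯ + c_{k-1} f + c_k = 0` with `k ≥ 1` and `c_i ∈ I ^ i`. -/
def Ideal.IsIntegralElem {R : Type*} [CommRing R] (I : Ideal R) (f : R) : Prop :=
  ∃ k : ℕ, 1 ≤ k ∧ ∃ c : ℕ → R, (∀ i ∈ Finset.Icc 1 k, c i ∈ I ^ i) ∧
    f ^ k + ∑ i ∈ Finset.Icc 1 k, c i * f ^ (k - i) = 0

/-- The integral closure of an ideal `I` of `R`: the set of elements integral over `I`. -/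
def Ideal.integralClosureSet {R : Type*} [CommRing R] (I : Ideal R) : Set R :=
  {f | I.IsIntegralElem f}

/-- An ideal is integrally closed if it equals its integral closure. -/
def Ideal.IsIntegrallyClosedIdeal {R : Type*} [CommRing R] (I : Ideal R) : Prop :=
  (I : Set R) = I.integralClosureSet

/-- An ideal is normal if all its powers `I ^ k`, `k ≥ 1`, are integrally closed. -/
def Ideal.IsNormalIdeal {R : Type*} [CommRing R] (I : Ideal R) : Prop :=
  ∀ k : ℕ, 1 ≤ k → (I ^ k).IsIntegrallyClosedIdeal

/-- The edge ideal of the edge-weighted graph `(G, ω)`: the ideal of `K[x_v : v ∈ V]` generated by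
`x_i ^ ω(e) * x_j ^ ω(e)` for the edges `e = {i, j}` of `G`. -/
noncomputable def SimpleGraph.weightedEdgeIdeal {V : Type*} (K : Type*) [Field K] (G : SimpleGraph V)
    (ω : G.edgeSet → ℕ+) : Ideal (MvPolynomial V K) :=
  Ideal.span {m | ∃ (i j : V) (h : s(i, j) ∈ G.edgeSet),
    m = MvPolynomial.X i ^ (ω ⟨s(i, j), h⟩ : ℕ) * MvPolynomial.X j ^ (ω ⟨s(i, j), h⟩ : ℕ)}

open MvPolynomial

/-! ### Integral elements and prime powers -/

/-! Call an edge heavy if its weight is at least 2. Integral closedness forces any two heavy edges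
to be joined by exactly one edge (`eq_add_two_of_isIntegrallyClosedIdeal`), so there are at most
two. Normality then follows from an integral form of LP duality: each monomial lies in some `I ^ k`
and has a vertex weighting giving every generator value at least 1 but the monomial value below `k +
1` (`hasSeparatingWeight`). Such a weighting is a monomial valuation, and valuations are respected
by integral equations (`Ideal.isIntegrallyClosedIdeal_pow_of_valuations`). The weighting is built by
peeling light edges off the ends until nothing, one heavy edge, or heavy-light-heavy remains. -/

theorem Ideal.isIntegralElem_of_mem {R : Type*} [CommRing R] {I : Ideal R} {f : R} (hf : f ∈ I) :
    I.IsIntegralElem f :=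
  ⟨1, le_rfl, fun _ => -f, by simpa using hf, by simp⟩

theorem Ideal.isIntegralElem_of_sq_mem {R : Type*} [CommRing R] {I : Ideal R} {f : R}
    (hf : f ^ 2 ∈ I ^ 2) : I.IsIntegralElem f := by
  refine ⟨2, by norm_num, fun i => if i = 2 then -f ^ 2 else 0, fun i _ => ?_, ?_⟩
  · by_cases h : i = 2
    · subst h
      simpa using hf
    · simp [h]
  · simp

theorem Ideal.IsIntegralElem.map {R S : Type*} [CommRing R] [CommRing S] {I : Ideal R} {f : R}
    (hf : I.IsIntegralElem f) (φ : R →+* S) {J : Ideal S} (hφ : I ≤ J.comap φ) :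
    J.IsIntegralElem (φ f) := by
  obtain ⟨k, hk, c, hc, h⟩ := hf
  refine ⟨k, hk, fun i => φ (c i), fun i hi => ?_, ?_⟩
  · have := Ideal.mem_map_of_mem φ (hc i hi)
    rw [Ideal.map_pow] at this
    exact Ideal.pow_right_mono (Ideal.map_le_iff_le_comap.2 hφ) i this
  · simpa using congrArg φ h

/-- If `p ^ e ∣ g` with `e < d`, the term `c i * g ^ (k - i)` is divisible by `p` to the power `d *
i + e * (k - i) ≥ e * k + 1`, since `i ≥ 1`. Hence so is `g ^ k`, and primality gives one more
factor `p` in `g`. -/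
theorem Ideal.IsIntegralElem.pow_dvd_of_prime {R : Type*} [CommRing R] [IsDomain R]
    {p g : R} (hp : Prime p) {d : ℕ} (hg : (Ideal.span {p ^ d}).IsIntegralElem g) :
    p ^ d ∣ g := by
  obtain ⟨k, -, c, hc, h⟩ := hg
  suffices H : ∀ e ≤ d, p ^ e ∣ g from H d le_rfl
  intro e
  induction e with
  | zero => simp
  | succ e ih =>
    intro he
    obtain ⟨q, rfl⟩ := ih (by omega)
    have hdvd : p ^ (e * k + 1) ∣ (p ^ e * q) ^ k := by
      rw [eq_neg_of_add_eq_zero_left h, dvd_neg]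
      refine Finset.dvd_sum fun i hi => ?_
      have hci := hc i hi
      rw [Finset.mem_Icc] at hi
      rw [Ideal.span_singleton_pow, Ideal.mem_span_singleton, ← pow_mul] at hci
      have h1 : p ^ (d * i) * p ^ (e * (k - i)) ∣ c i * (p ^ e * q) ^ (k - i) := by
        refine mul_dvd_mul hci ?_
        rw [mul_pow, ← pow_mul]
        exact dvd_mul_right _ _
      refine dvd_trans ?_ h1
      rw [← pow_add]
      refine pow_dvd_pow p ?_
      obtain ⟨j, rfl⟩ := Nat.exists_eq_add_of_le hi.2
      rw [Nat.add_sub_cancel_left, mul_add]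
      nlinarith
    rw [mul_pow, ← pow_mul, pow_succ] at hdvd
    have hq := hp.dvd_of_dvd_pow
      ((mul_dvd_mul_iff_left (pow_ne_zero (e * k) hp.ne_zero)).1 hdvd)
    rw [pow_succ]
    exact mul_dvd_mul_left _ hq

/-! ### Monomial valuations -/

/-- The homomorphism `X v ↦ X v * T ^ c v` whose `T`-adic order is the monomial valuation of
weight `c`. -/
noncomputable def MvPolynomial.weightGrading {σ : Type*} (K : Type*) [Field K] (c : σ → ℕ) :
    MvPolynomial σ K →ₐ[K] Polynomial (MvPolynomial σ K) :=
  aeval fun v => Polynomial.C (X v) * Polynomial.X ^ c v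

section

variable {σ K : Type*} [Field K] (c : σ → ℕ)

theorem MvPolynomial.weightGrading_monomial (s : σ →₀ ℕ) (a : K) :
    weightGrading K c (monomial s a) =
      Polynomial.C (monomial s a) * Polynomial.X ^ (s.sum fun v e => c v * e) := by
  rw [weightGrading, aeval_monomial, monomial_eq (s := s)]
  simp only [Finsupp.prod, Finsupp.sum, mul_pow, Finset.prod_mul_distrib, map_mul, map_prod,
    map_pow, ← pow_mul, Finset.prod_pow_eq_pow_sum, mul_assoc]
  rfl

/-- Since the variables survive in the coefficients, distinct monomials of equal weight cannot
cancel, so the `T`-order sees every monomial of `f`. -/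
theorem MvPolynomial.coeff_coeff_weightGrading (f : MvPolynomial σ K) (s : σ →₀ ℕ) (j : ℕ) :
    coeff s ((weightGrading K c f).coeff j) =
      if (s.sum fun v e => c v * e) = j then coeff s f else 0 := by
  classical
  induction f using MvPolynomial.induction_on' with
  | monomial t a =>
    rw [weightGrading_monomial, Polynomial.coeff_C_mul_X_pow, coeff_monomial]
    by_cases hts : t = s
    · subst hts
      by_cases hj : j = t.sum fun v e => c v * e
      · simp [hj]
      · rw [if_neg hj, if_neg (Ne.symm hj), coeff_zero]
    · split_ifs <;> simp [hts]
  | add p q hp hq =>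
    rw [map_add, Polynomial.coeff_add, coeff_add, hp, hq, coeff_add]
    split_ifs <;> simp

theorem MvPolynomial.le_weight_of_X_pow_dvd_weightGrading {f : MvPolynomial σ K} {d : ℕ}
    (h : Polynomial.X ^ d ∣ weightGrading K c f) {s : σ →₀ ℕ} (hs : s ∈ f.support) :
    d ≤ s.sum fun v e => c v * e := by
  by_contra! hlt
  have h0 := Polynomial.X_pow_dvd_iff.1 h _ hlt
  have := coeff_coeff_weightGrading c f s (s.sum fun v e => c v * e)
  rw [h0, if_pos rfl, coeff_zero] at this
  exact (mem_support_iff.1 hs) this.symm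

/-- If every monomial outside `I ^ k` can be separated from `I ^ k` by a monomial valuation, then
`I ^ k` is integrally closed. -/
theorem Ideal.isIntegrallyClosedIdeal_pow_of_valuations {I : Ideal (MvPolynomial σ K)} {k : ℕ}
    (H : ∀ s : σ →₀ ℕ, monomial s 1 ∉ I ^ k → ∃ (c : σ → ℕ) (d : ℕ),
      (∀ f ∈ I, Polynomial.X ^ d ∣ weightGrading K c f) ∧ (s.sum fun v e => c v * e) < d * k) :
    (I ^ k).IsIntegrallyClosedIdeal := by
  refine Set.Subset.antisymm (fun f hf => Ideal.isIntegralElem_of_mem hf) fun f hf => ?_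
  change f ∈ I ^ k
  rw [f.as_sum]
  refine Ideal.sum_mem _ fun s hs => ?_
  rw [← mul_one (coeff s f), ← C_mul_monomial]
  refine Ideal.mul_mem_left _ _ ?_
  by_contra hsI
  obtain ⟨c, d, hd, hlt⟩ := H s hsI
  have hle : I ≤ (Ideal.span {(Polynomial.X : Polynomial (MvPolynomial σ K)) ^ d}).comap
      (weightGrading K c : MvPolynomial σ K →+* _) :=
    fun g hg => Ideal.mem_span_singleton.2 (hd g hg)
  have hle' : I ^ k ≤ (Ideal.span {(Polynomial.X : Polynomial (MvPolynomial σ K)) ^ (d * k)}).comap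
      (weightGrading K c : MvPolynomial σ K →+* _) := by
    rw [pow_mul, ← Ideal.span_singleton_pow]
    exact (Ideal.pow_right_mono hle k).trans (Ideal.le_comap_pow _ k)
  have hdvd := (Ideal.IsIntegralElem.map hf _ hle').pow_dvd_of_prime Polynomial.prime_X
  exact absurd (le_weight_of_X_pow_dvd_weightGrading c hdvd hs) (not_le.2 hlt)

end

/-! ### Weighted paths -/

/-- The exponent of `x_i * x_{i+1}`. -/
def edgeExponent (i : ℕ) : ℕ → ℕ := fun v => if v = i ∨ v = i + 1 then 1 else 0

/-- The monomial of `K[x_0, …, x_{n-1}]` with exponents `E 0, …, E (n - 1)`. -/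
noncomputable def pathMonomial (K : Type*) [Field K] (n : ℕ) (E : ℕ → ℕ) :
    MvPolynomial (Fin n) K :=
  monomial (Finsupp.equivFunOnFinite.symm fun v : Fin n => E v) 1

/-- The edge ideal of the path on `n` vertices whose edge `{i, i + 1}` has weight `w i`. -/
noncomputable def pathIdeal (K : Type*) [Field K] (n : ℕ) (w : ℕ → ℕ) :
    Ideal (MvPolynomial (Fin n) K) :=
  Ideal.span {f | ∃ i, i + 1 < n ∧ f = pathMonomial K n (w i • edgeExponent i)}

/-- The value of the weight vector `c` at the exponent `E`. -/
def pathCost (n : ℕ) (c E : ℕ → ℕ) : ℕ := ∑ v ∈ Finset.range n, c v * E v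

section

variable (K : Type*) [Field K] {n : ℕ} {w : ℕ → ℕ}

theorem pathMonomial_add (E F : ℕ → ℕ) :
    pathMonomial K n (E + F) = pathMonomial K n E * pathMonomial K n F := by
  rw [pathMonomial, pathMonomial, pathMonomial, monomial_mul, one_mul]
  refine congrArg (fun s => monomial s (1 : K)) ?_
  ext v
  rfl

theorem pathMonomial_nsmul (m : ℕ) (E : ℕ → ℕ) :
    pathMonomial K n (m • E) = pathMonomial K n E ^ m := by
  rw [pathMonomial, pathMonomial, monomial_pow, one_pow]
  refine congrArg (fun s => monomial s (1 : K)) ?_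
  ext v
  rfl

theorem pathMonomial_edgeExponent {i : ℕ} (hi : i + 1 < n) :
    pathMonomial K n (edgeExponent i) = X ⟨i, by omega⟩ * X ⟨i + 1, hi⟩ := by
  classical
  rw [pathMonomial, X, X, monomial_mul, one_mul]
  refine congrArg (fun s => monomial s (1 : K)) ?_
  ext v
  simp only [edgeExponent, Finsupp.equivFunOnFinite_symm_apply_apply, Finsupp.add_apply,
    Finsupp.single_apply, Fin.ext_iff]
  split_ifs <;> omega

theorem pathMonomial_mem_pathIdeal {i : ℕ} (hi : i + 1 < n) :
    pathMonomial K n (w i • edgeExponent i) ∈ pathIdeal K n w :=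
  Ideal.subset_span ⟨i, hi, rfl⟩

theorem pathMonomial_add_mem_pow {i : ℕ} (hi : i + 1 < n) (m : ℕ) {k : ℕ} {E : ℕ → ℕ}
    (hE : pathMonomial K n E ∈ pathIdeal K n w ^ k) :
    pathMonomial K n (E + (w i * m) • edgeExponent i) ∈ pathIdeal K n w ^ (k + m) := by
  rw [pathMonomial_add, pow_add, mul_comm (w i), mul_smul, pathMonomial_nsmul K m]
  exact Ideal.mul_mem_mul hE (Ideal.pow_mem_pow (pathMonomial_mem_pathIdeal K hi) m)

theorem exists_le_of_pathMonomial_mem {E : ℕ → ℕ} (hE : pathMonomial K n E ∈ pathIdeal K n w) :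
    ∃ i, i + 1 < n ∧ w i ≤ E i ∧ w i ≤ E (i + 1) := by
  classical
  have hset : {f | ∃ i, i + 1 < n ∧ f = pathMonomial K n (w i • edgeExponent i)} =
      (fun s => monomial s (1 : K)) '' {s | ∃ i, i + 1 < n ∧
        s = Finsupp.equivFunOnFinite.symm fun v : Fin n => (w i • edgeExponent i) v} := by
    ext f
    constructor
    · rintro ⟨i, hi, rfl⟩
      exact ⟨_, ⟨i, hi, rfl⟩, rfl⟩
    · rintro ⟨_, ⟨i, hi, rfl⟩, rfl⟩
      exact ⟨i, hi, rfl⟩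
  rw [pathIdeal, hset, mem_ideal_span_monomial_image] at hE
  obtain ⟨_, ⟨i, hi, rfl⟩, hle⟩ := hE (Finsupp.equivFunOnFinite.symm fun v : Fin n => E v)
    (by simp [pathMonomial, mem_support_iff, coeff_monomial])
  refine ⟨i, hi, ?_, ?_⟩
  · simpa [edgeExponent] using hle ⟨i, by omega⟩
  · simpa [edgeExponent] using hle ⟨i + 1, hi⟩

theorem SimpleGraph.weightedEdgeIdeal_pathGraph_eq (ω : (SimpleGraph.pathGraph n).edgeSet → ℕ+) :
    ∃ w : ℕ → ℕ, (∀ i, 1 ≤ w i) ∧ (∀ i, 2 ≤ w i → i + 1 < n) ∧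
      (SimpleGraph.pathGraph n).weightedEdgeIdeal K ω = pathIdeal K n w := by
  have hadj : ∀ (i : ℕ) (hi : i + 1 < n), s((⟨i, by omega⟩ : Fin n), (⟨i + 1, hi⟩ : Fin n)) ∈
      (SimpleGraph.pathGraph n).edgeSet := fun i hi => by
    rw [SimpleGraph.mem_edgeSet, SimpleGraph.pathGraph_adj]
    exact Or.inl rfl
  -- Indices that are not edges get weight 1, so they never count as heavy.
  refine ⟨fun i => if hi : i + 1 < n then (ω ⟨_, hadj i hi⟩ : ℕ) else 1, fun i => ?_, fun i h => ?_,
    ?_⟩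
  · dsimp only
    split_ifs
    · exact (ω ⟨_, hadj i ‹_›⟩).pos
    · exact le_rfl
  · by_contra hi
    simp [hi] at h
  · rw [SimpleGraph.weightedEdgeIdeal, pathIdeal]
    congr 1
    ext f
    constructor
    · rintro ⟨u, v, h, rfl⟩
      have huv := h
      rw [SimpleGraph.mem_edgeSet, SimpleGraph.pathGraph_adj] at huv
      rcases huv with huv | huv
      · have hi : (u : ℕ) + 1 < n := huv ▸ v.isLt
        obtain rfl : v = ⟨u + 1, hi⟩ := Fin.ext huv.symm
        refine ⟨u, hi, ?_⟩
        rw [dif_pos hi, pathMonomial_nsmul, pathMonomial_edgeExponent K hi, mul_pow]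
      · have hi : (v : ℕ) + 1 < n := huv ▸ u.isLt
        obtain rfl : u = ⟨v + 1, hi⟩ := Fin.ext huv.symm
        have hsym : (⟨_, h⟩ : (SimpleGraph.pathGraph n).edgeSet) = ⟨_, hadj v hi⟩ :=
          Subtype.ext Sym2.eq_swap
        refine ⟨v, hi, ?_⟩
        rw [dif_pos hi, pathMonomial_nsmul, pathMonomial_edgeExponent K hi, mul_pow, hsym, mul_comm]
    · rintro ⟨i, hi, rfl⟩
      refine ⟨_, _, hadj i hi, ?_⟩
      rw [dif_pos hi, pathMonomial_nsmul, pathMonomial_edgeExponent K hi, mul_pow]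

variable {K}

/-- In an integrally closed edge ideal of a weighted path, two edges of weight at least two are
joined by exactly one edge. -/
theorem eq_add_two_of_isIntegrallyClosedIdeal (hI : (pathIdeal K n w).IsIntegrallyClosedIdeal)
    (hw : ∀ i, 1 ≤ w i) (hn : ∀ i, 2 ≤ w i → i + 1 < n) {i j : ℕ} (hij : i < j)
    (hi : 2 ≤ w i) (hj : 2 ≤ w j) : j = i + 2 := by
  by_contra hne
  -- Rounding half the weights up makes the square of the monomial divisible by the product of both
  -- generators.
  set s := (w i + 1) / 2 with hs
  set t := (w j + 1) / 2 with ht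
  set E : ℕ → ℕ := s • edgeExponent i + t • edgeExponent j with hE
  have hsq : pathMonomial K n E ^ 2 ∈ pathIdeal K n w ^ 2 := by
    have key : ∀ l r, l + 1 < n → w l ≤ 2 * r →
        pathMonomial K n (r • edgeExponent l) ^ 2 ∈ pathIdeal K n w := by
      intro l r hl hr
      obtain ⟨q, hq⟩ := Nat.exists_eq_add_of_le hr
      rw [← pathMonomial_nsmul, smul_smul, hq, add_smul, pathMonomial_add]
      exact Ideal.mul_mem_right _ _ (pathMonomial_mem_pathIdeal K hl)
    rw [hE, pathMonomial_add, mul_pow, sq (pathIdeal K n w)]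
    exact Ideal.mul_mem_mul (key i s (hn i hi) (by omega)) (key j t (hn j hj) (by omega))
  have hmem : pathMonomial K n E ∈ pathIdeal K n w := by
    have : pathMonomial K n E ∈ (pathIdeal K n w : Set _) := by
      rw [hI]
      exact Ideal.isIntegralElem_of_sq_mem hsq
    exact this
  -- Neither generator divides: the outer ends of the two edges have exponents `s < w i` and `t < w
  -- j`. A third edge lies in the support only if it joins the two, that is, if `j = i + 2`.
  obtain ⟨l, -, h1, h2⟩ := exists_le_of_pathMonomial_mem K hmem
  have hl := hw l
  simp only [hE, edgeExponent, Pi.add_apply, Pi.smul_apply, smul_eq_mul] at h1 h2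
  by_cases hli : l = i
  · subst hli
    rw [if_pos (by omega), if_neg (by omega)] at h1
    omega
  · by_cases hlj : l = j
    · subst hlj
      rw [if_neg (by omega), if_pos (by omega)] at h2
      omega
    · split_ifs at h1 h2 <;> omega

/-! ### Weight vectors separating a monomial from the powers of the edge ideal -/

theorem weight_edgeExponent (c : Fin n → ℕ) (E : ℕ → ℕ) :
    ((Finsupp.equivFunOnFinite.symm fun v : Fin n => E v).sum fun v e => c v * e) =
      ∑ v, c v * E v := by
  rw [Finsupp.sum_fintype _ _ (by simp)]
  simp

theorem pathCost_add (c E F : ℕ → ℕ) : pathCost n c (E + F) = pathCost n c E + pathCost n c F := by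
  simp [pathCost, mul_add, Finset.sum_add_distrib]

theorem pathCost_smul_edgeExponent (c : ℕ → ℕ) (m : ℕ) {i : ℕ} (hi : i + 1 < n) :
    pathCost n c (m • edgeExponent i) = m * (c i + c (i + 1)) := by
  have h : ∀ v, c v * (m • edgeExponent i) v =
      (if v = i then m * c i else 0) + (if v = i + 1 then m * c (i + 1) else 0) := by
    intro v
    simp only [edgeExponent, Pi.smul_apply, smul_eq_mul]
    by_cases h1 : v = i
    · subst h1
      simp [mul_comm]
    · by_cases h2 : v = i + 1
      · subst h2
        simp [mul_comm]
      · simp [h1, h2]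
  rw [pathCost, Finset.sum_congr rfl fun v _ => h v, Finset.sum_add_distrib,
    Finset.sum_ite_eq', Finset.sum_ite_eq', if_pos (Finset.mem_range.2 (by omega)),
    if_pos (Finset.mem_range.2 hi), mul_add]

theorem pathCost_mono {c c' E : ℕ → ℕ} (h : ∀ v, E v ≠ 0 → c v ≤ c' v) :
    pathCost n c E ≤ pathCost n c' E := by
  refine Finset.sum_le_sum fun v _ => ?_
  by_cases hv : E v = 0
  · simp [hv]
  · exact Nat.mul_le_mul_right _ (h v hv)

theorem pathCost_pair {E : ℕ → ℕ} {u v : ℕ} (huv : u ≠ v) (hu : u < n) (hv : v < n) (a b : ℕ) :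
    pathCost n (fun x => if x = u then a else if x = v then b else 0) E = a * E u + b * E v := by
  have h : ∀ x, (if x = u then a else if x = v then b else 0) * E x =
      (if x = u then a * E u else 0) + (if x = v then b * E v else 0) := by
    intro x
    by_cases h1 : x = u
    · subst h1
      simp [huv]
    · by_cases h2 : x = v
      · subst h2
        simp [h1]
      · simp [h1, h2]
  rw [pathCost, Finset.sum_congr rfl fun x _ => h x, Finset.sum_add_distrib,
    Finset.sum_ite_eq', Finset.sum_ite_eq', if_pos (Finset.mem_range.2 hu),
    if_pos (Finset.mem_range.2 hv)]

variable (K n w) in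
/-- For the path with edges `l, …, r - 1`: the monomial of exponent `E` lies in the `k`-th power
of the edge ideal, and the weight vector `c / D` shows that `k` is the largest such power. (An even
denominator `D` leaves room to split an edge evenly.) -/
def HasSeparatingWeight (l r : ℕ) (E : ℕ → ℕ) : Prop :=
  ∃ (k D : ℕ) (c : ℕ → ℕ), 0 < D ∧ Even D ∧ (∀ v, c v ≤ D) ∧
    (∀ i, l ≤ i → i < r → D ≤ w i * (c i + c (i + 1))) ∧
    pathMonomial K n E ∈ pathIdeal K n w ^ k ∧ pathCost n c E < D * (k + 1)

theorem hasSeparatingWeight_of_le {l r : ℕ} (h : r ≤ l) (E : ℕ → ℕ) :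
    HasSeparatingWeight K n w l r E :=
  ⟨0, 2, 0, two_pos, even_two, by simp, fun i _ _ => by omega, by simp, by simp [pathCost]⟩

theorem exists_eq_add_smul_edgeExponent {E : ℕ → ℕ} {e m : ℕ} (h1 : m ≤ E e)
    (h2 : m ≤ E (e + 1)) : ∃ F : ℕ → ℕ, E = F + m • edgeExponent e := by
  refine ⟨fun v => E v - m * edgeExponent e v, ?_⟩
  ext v
  simp only [Pi.add_apply, Pi.smul_apply, smul_eq_mul]
  refine (Nat.sub_add_cancel ?_).symm
  rw [edgeExponent]
  split_ifs with h
  · rcases h with rfl | rfl <;> simpa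
  · simp

/-- An edge `e` of weight one can be used as often as possible, when a weight vector for the
remaining monomial extends to `e`. Here `u` is the vertex of `e` that is exhausted. -/
theorem hasSeparatingWeight_of_edge {l r l' r' e u : ℕ} (he : e + 1 < n) (hwe : w e = 1)
    (hw : ∀ i, 1 ≤ w i) {E F : ℕ → ℕ} (m : ℕ) (hE : E = F + m • edgeExponent e) (hFu : F u = 0)
    (hF : HasSeparatingWeight K n w l' r' F)
    (hext : ∀ (D : ℕ) (c : ℕ → ℕ), Even D → (∀ v, c v ≤ D) →
      (∀ i, l' ≤ i → i < r' → D ≤ w i * (c i + c (i + 1))) →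
      ∃ c' : ℕ → ℕ, (∀ v, c' v ≤ D) ∧ c' e + c' (e + 1) = D ∧ (∀ v, v ≠ u → c' v ≤ c v) ∧
        (∀ i, l ≤ i → i < r → i ≠ e → D ≤ w i * (c' i + c' (i + 1)))) :
    HasSeparatingWeight K n w l r E := by
  obtain ⟨k, D, c, hD, hD2, hcD, hc, hk, hlt⟩ := hF
  obtain ⟨c', hcD', hce, hle, hc'⟩ := hext D c hD2 hcD hc
  refine ⟨k + m, D, c', hD, hD2, hcD', fun i h1 h2 => ?_, ?_, ?_⟩
  · by_cases hi : i = e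
    · subst hi
      rw [hce]
      exact Nat.le_mul_of_pos_left _ (hw _)
    · exact hc' i h1 h2 hi
  · have := pathMonomial_add_mem_pow K he m hk
    rwa [hwe, one_mul, ← hE] at this
  -- As `F` vanishes at `u`, raising the weight there is free; the `m` copies of `e` add exactly `m
  -- * D`.
  · have hm : pathCost n c' F ≤ pathCost n c F :=
      pathCost_mono fun v hv => hle v fun h => hv (h ▸ hFu)
    rw [hE, pathCost_add, pathCost_smul_edgeExponent c' m he, hce]
    nlinarith

/-- If the outer vertex `l` is exhausted, it receives the complement `D - c (l + 1)`. If `l + 1` is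
exhausted, it receives all of `D`, which only helps the next edge. -/
theorem hasSeparatingWeight_left {l r : ℕ} (hr : ∀ i < r, i + 1 < n) (hlr : l < r)
    (hw : ∀ i, 1 ≤ w i) (hwl : w l = 1) (ih : ∀ E, HasSeparatingWeight K n w (l + 1) r E)
    (E : ℕ → ℕ) : HasSeparatingWeight K n w l r E := by
  rcases le_total (E l) (E (l + 1)) with h | h
  · obtain ⟨F, hF⟩ := exists_eq_add_smul_edgeExponent (E := E) (e := l) le_rfl h
    refine hasSeparatingWeight_of_edge (u := l) (hr l hlr) hwl hw (E l) hF ?_ (ih F) ?_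
    · have := congrFun hF l
      simp [edgeExponent] at this
      exact this
    · intro D c _ hcD hc
      refine ⟨fun v => if v = l then D - c (l + 1) else c v, fun v => ?_, ?_, fun v hv => ?_,
        fun i h1 h2 h3 => ?_⟩
      · dsimp only
        split_ifs
        · omega
        · exact hcD v
      · simp [Nat.sub_add_cancel (hcD (l + 1))]
      · simp [hv]
      · simp only [if_neg h3, if_neg (show i + 1 ≠ l by omega)]
        exact hc i (by omega) h2
  · obtain ⟨F, hF⟩ := exists_eq_add_smul_edgeExponent (E := E) (e := l) h le_rfl
    refine hasSeparatingWeight_of_edge (u := l + 1) (hr l hlr) hwl hw (E (l + 1)) hF ?_ (ih F) ?_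
    · have := congrFun hF (l + 1)
      simp [edgeExponent] at this
      exact this
    · intro D c _ hcD hc
      refine ⟨fun v => if v = l then 0 else if v = l + 1 then D else c v, fun v => ?_, ?_,
        fun v hv => ?_, fun i h1 h2 h3 => ?_⟩
      · dsimp only
        split_ifs
        · omega
        · omega
        · exact hcD v
      · simp
      · dsimp only
        rw [if_neg hv]
        split_ifs <;> omega
      · refine (hc i (by omega) h2).trans (Nat.mul_le_mul_left _ ?_)
        have := hcD i
        dsimp only
        rw [if_neg h3, if_neg (show i + 1 ≠ l by omega), if_neg (show i + 1 ≠ l + 1 by omega)]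
        split_ifs <;> omega

theorem hasSeparatingWeight_right {l r : ℕ} (hr : r + 1 < n)
    (hw : ∀ i, 1 ≤ w i) (hwr : w r = 1) (ih : ∀ E, HasSeparatingWeight K n w l r E)
    (E : ℕ → ℕ) : HasSeparatingWeight K n w l (r + 1) E := by
  rcases le_total (E r) (E (r + 1)) with h | h
  · obtain ⟨F, hF⟩ := exists_eq_add_smul_edgeExponent (E := E) (e := r) le_rfl h
    refine hasSeparatingWeight_of_edge (u := r) hr hwr hw (E r) hF ?_ (ih F) ?_
    · have := congrFun hF r
      simp [edgeExponent] at this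
      exact this
    · intro D c _ hcD hc
      refine ⟨fun v => if v = r + 1 then 0 else if v = r then D else c v, fun v => ?_, ?_,
        fun v hv => ?_, fun i h1 h2 h3 => ?_⟩
      · dsimp only
        split_ifs
        · omega
        · omega
        · exact hcD v
      · simp
      · dsimp only
        rw [if_neg hv]
        split_ifs <;> omega
      · refine (hc i h1 (by omega)).trans (Nat.mul_le_mul_left _ ?_)
        have := hcD (i + 1)
        dsimp only
        rw [if_neg (show i ≠ r + 1 by omega), if_neg h3, if_neg (show i + 1 ≠ r + 1 by omega)]
        split_ifs <;> omega
  · obtain ⟨F, hF⟩ := exists_eq_add_smul_edgeExponent (E := E) (e := r) h le_rfl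
    refine hasSeparatingWeight_of_edge (u := r + 1) hr hwr hw (E (r + 1)) hF ?_ (ih F) ?_
    · have := congrFun hF (r + 1)
      simp [edgeExponent] at this
      exact this
    · intro D c _ hcD hc
      refine ⟨fun v => if v = r + 1 then D - c r else c v, fun v => ?_, ?_, fun v hv => ?_,
        fun i h1 h2 h3 => ?_⟩
      · dsimp only
        split_ifs
        · omega
        · exact hcD v
      · simp [Nat.add_sub_cancel' (hcD r)]
      · simp [hv]
      · simp only [if_neg (show i ≠ r + 1 by omega), if_neg (show i + 1 ≠ r + 1 by omega)]
        exact hc i h1 (by omega)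

/-! ### Base cases with heavy end edges, and the induction -/

theorem pathMonomial_mem_pow_div {E : ℕ → ℕ} {e : ℕ} (he : e + 1 < n) :
    pathMonomial K n E ∈ pathIdeal K n w ^ (min (E e) (E (e + 1)) / w e) := by
  have hle := Nat.mul_div_le (min (E e) (E (e + 1))) (w e)
  obtain ⟨F, hF⟩ := exists_eq_add_smul_edgeExponent (hle.trans (min_le_left _ _))
    (hle.trans (min_le_right _ _))
  have := pathMonomial_add_mem_pow (w := w) K he (min (E e) (E (e + 1)) / w e)
    (show pathMonomial K n F ∈ pathIdeal K n w ^ 0 by simp)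
  rwa [← hF, zero_add] at this

theorem hasSeparatingWeight_single {l : ℕ} (hl : l + 1 < n) (hw : ∀ i, 1 ≤ w i) (E : ℕ → ℕ) :
    HasSeparatingWeight K n w l (l + 1) E := by
  have hlt := Nat.lt_mul_div_succ (min (E l) (E (l + 1))) (hw l)
  rcases le_total (E l) (E (l + 1)) with h | h
  · refine ⟨_, 2 * w l, fun x => if x = l then 2 else if x = l + 1 then 0 else 0,
      Nat.mul_pos two_pos (hw l), even_two_mul _, fun v => ?_,
      fun i h1 h2 => ?_, pathMonomial_mem_pow_div hl, ?_⟩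
    · have := hw l
      dsimp only
      split_ifs <;> omega
    · obtain rfl : i = l := by omega
      simp [mul_comm]
    · rw [pathCost_pair (by omega) (by omega) hl]
      rw [min_eq_left h] at hlt ⊢
      nlinarith
  · refine ⟨_, 2 * w l, fun x => if x = l then 0 else if x = l + 1 then 2 else 0,
      Nat.mul_pos two_pos (hw l), even_two_mul _, fun v => ?_,
      fun i h1 h2 => ?_, pathMonomial_mem_pow_div hl, ?_⟩
    · have := hw l
      dsimp only
      split_ifs <;> omega
    · obtain rfl : i = l := by omega
      simp [mul_comm]
    · rw [pathCost_pair (by omega) (by omega) hl]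
      rw [min_eq_right h] at hlt ⊢
      nlinarith

/-- Three consecutive edges, the middle one of weight one and the others of weight at least two. -/
theorem hasSeparatingWeight_triple {l : ℕ} (hl : l + 3 < n) (hw : ∀ i, 1 ≤ w i)
    (h0 : 2 ≤ w l) (h1 : w (l + 1) = 1) (h2 : 2 ≤ w (l + 2)) (E : ℕ → ℕ) :
    HasSeparatingWeight K n w l (l + 3) E := by
  rcases le_total (E (l + 1)) (E (l + 2)) with h | h
  · obtain ⟨F, hF⟩ := exists_eq_add_smul_edgeExponent (E := E) (e := l + 1) le_rfl h
    refine hasSeparatingWeight_of_edge (u := l + 1) (by omega) h1 hw (E (l + 1)) hF ?_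
      (hasSeparatingWeight_single hl hw F) ?_
    · have := congrFun hF (l + 1)
      simp [edgeExponent] at this
      exact this
    · rintro D c ⟨D', rfl⟩ hcD hc
      -- Capping the weight at `l + 2` by `D / 2` leaves at least `D / 2` for `l + 1`. Half of `D`
      -- at one endpoint suffices for a heavy edge, so both outer edges remain satisfied.
      refine ⟨fun v => if v = l + 1 then D' + D' - min (c (l + 2)) D' else
        if v = l + 2 then min (c (l + 2)) D' else if v = l then 0 else c v, fun v => ?_, ?_,
        fun v hv => ?_, fun i hi1 hi2 hi3 => ?_⟩
      · have := hcD v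
        dsimp only
        split_ifs <;> omega
      · simp
      · dsimp only
        rw [if_neg hv]
        split_ifs with hv2
        · rw [hv2]
          exact min_le_left _ _
        · omega
        · exact le_rfl
      · obtain rfl | rfl : i = l ∨ i = l + 2 := by omega
        · refine le_trans ?_ (Nat.mul_le_mul_right _ h0)
          simp
          omega
        · have := hc (l + 2) le_rfl (by omega)
          rcases le_total (c (l + 2)) D' with hle | hle
          · simpa [hle, show l + 2 + 1 ≠ l by omega] using this
          · refine le_trans ?_ (Nat.mul_le_mul_right _ h2)
            simp [hle]
            omega
  · obtain ⟨F, hF⟩ := exists_eq_add_smul_edgeExponent (E := E) (e := l + 1) h le_rfl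
    refine hasSeparatingWeight_of_edge (u := l + 2) (by omega) h1 hw (E (l + 2)) hF ?_
      (hasSeparatingWeight_single (l := l) (by omega) hw F) ?_
    · have := congrFun hF (l + 2)
      simp [edgeExponent] at this
      exact this
    · rintro D c ⟨D', rfl⟩ hcD hc
      refine ⟨fun v => if v = l + 2 then D' + D' - min (c (l + 1)) D' else
        if v = l + 1 then min (c (l + 1)) D' else if v = l + 3 then 0 else c v, fun v => ?_, ?_,
        fun v hv => ?_, fun i hi1 hi2 hi3 => ?_⟩
      · have := hcD v
        dsimp only
        split_ifs <;> omega
      · simp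
      · dsimp only
        rw [if_neg hv]
        split_ifs with hv2
        · rw [hv2]
          exact min_le_left _ _
        · omega
        · exact le_rfl
      · obtain rfl | rfl : i = l ∨ i = l + 2 := by omega
        · have := hc i le_rfl (by omega)
          rcases le_total (c (i + 1)) D' with hle | hle
          · simpa [hle] using this
          · refine le_trans ?_ (Nat.mul_le_mul_right _ h0)
            simp [hle]
            omega
        · refine le_trans ?_ (Nat.mul_le_mul_right _ h2)
          simp
          omega

theorem hasSeparatingWeight (hw : ∀ i, 1 ≤ w i)
    (hheavy : ∀ i j, i < j → 2 ≤ w i → 2 ≤ w j → j = i + 2) (d : ℕ) :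
    ∀ l r, r = l + d → (∀ i < r, i + 1 < n) → ∀ E, HasSeparatingWeight K n w l r E := by
  induction d with
  | zero => exact fun l r h _ E => hasSeparatingWeight_of_le (by omega) E
  | succ d ih =>
    rintro l _ rfl hr E
    by_cases hl : w l = 1
    · exact hasSeparatingWeight_left hr (by omega) hw hl (ih (l + 1) _ (by omega) hr) E
    by_cases hd : w (l + d) = 1
    · exact hasSeparatingWeight_right (hr _ (by omega)) hw hd
        (ih l _ rfl fun i hi => hr i (by omega)) E
    have hl' := hw l
    have hd' := hw (l + d)
    rcases Nat.eq_zero_or_pos d with rfl | hpos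
    · exact hasSeparatingWeight_single (hr _ (by omega)) hw E
    -- Both end edges are now heavy and distinct, so they are two apart.
    · obtain rfl : d = 2 := by
        have := hheavy l (l + d) (by omega) (by omega) (by omega)
        omega
      have hmid : w (l + 1) = 1 := by
        by_contra hmid
        have := hw (l + 1)
        have := hheavy l (l + 1) (by omega) (by omega) (by omega)
        omega
      exact hasSeparatingWeight_triple (hr (l + 2) (by omega)) hw (by omega) hmid (by omega) E

theorem isNormalIdeal_pathIdeal (hw : ∀ i, 1 ≤ w i)
    (hheavy : ∀ i j, i < j → 2 ≤ w i → 2 ≤ w j → j = i + 2) :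
    (pathIdeal K n w).IsNormalIdeal := by
  intro k _
  refine Ideal.isIntegrallyClosedIdeal_pow_of_valuations fun s hs => ?_
  set E : ℕ → ℕ := fun v => if h : v < n then s ⟨v, h⟩ else 0 with hE
  have hsE : s = Finsupp.equivFunOnFinite.symm fun v : Fin n => E v := by
    ext v
    simp [hE]
  obtain ⟨k', D, c, -, -, -, hc, hk, hlt⟩ := hasSeparatingWeight (K := K) (n := n) hw hheavy (n - 1) 0
    (n - 1) (by omega) (fun i hi => by omega) E
  -- The monomial lies in the `k'`-th power but not the `k`-th, so its cost is below `D * (k' + 1) ≤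
  -- D * k`.
  have hkk : k' < k := by
    by_contra! hle
    refine hs (Ideal.pow_le_pow_right hle ?_)
    rw [hsE]
    exact hk
  have hcost : ∀ F : ℕ → ℕ, ((Finsupp.equivFunOnFinite.symm fun v : Fin n => F v).sum
      fun v e => c v * e) = pathCost n c F := fun F => by
    rw [weight_edgeExponent fun v : Fin n => c v, pathCost, Finset.sum_range]
  refine ⟨fun v => c v, D, fun f hf => ?_, ?_⟩
  · suffices h : pathIdeal K n w ≤ (Ideal.span {(Polynomial.X : Polynomial _) ^ D}).comap
        (weightGrading K fun v : Fin n => c v) from Ideal.mem_span_singleton.1 (h hf)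
    rw [pathIdeal, Ideal.span_le]
    rintro _ ⟨i, hi, rfl⟩
    refine Ideal.mem_span_singleton.2 ?_
    rw [pathMonomial, weightGrading_monomial, hcost, pathCost_smul_edgeExponent _ _ hi]
    exact Dvd.dvd.mul_left (pow_dvd_pow _ (hc i (by omega) (by omega))) _
  · rw [hsE, hcost]
    exact hlt.trans_le (Nat.mul_le_mul_left _ hkk)

end

theorem theorem4p10 (K : Type*) [Field K] (n : ℕ)
    (ω : (SimpleGraph.pathGraph n).edgeSet → ℕ+)
    (hI : ((SimpleGraph.pathGraph n).weightedEdgeIdeal K ω).IsIntegrallyClosedIdeal) :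
    ((SimpleGraph.pathGraph n).weightedEdgeIdeal K ω).IsNormalIdeal := by
  obtain ⟨w, hw, hn, h⟩ := SimpleGraph.weightedEdgeIdeal_pathGraph_eq K ω
  rw [h] at hI ⊢
  exact isNormalIdeal_pathIdeal hw fun i j hij hi hj =>
    eq_add_two_of_isIntegrallyClosedIdeal hI hw hn hij hi hj
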